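/- Frameworks are in the plane. Let $G=(V,E,A)$ consist of a finite vertex set $V$, a set $E$ of undirected edges without self-loops, and a set $A$ of angle constraints $\theta_{ij}^{k}$ (the angle in $[0,\pi]$ at $k$ subtended by $i$ and $j$; $i,j,k\in V$ distinct, $\theta^k_{ij}=\theta^k_{ji}$; $ik$ and $jk$ need not be edges). Let $p:V\to\mathbb{R}^2$ be a configuration with pairwise distinct points $p_v$. The frameworks $(G,p)$ and $(G,q)$ are *strongly equivalent* if all lengths of edges in $E$ and all angles in $A$ agree, and *congruent* if all distances between vertices agree. The framework $(G,p)$ is *weakly rigid* if there is a neighbourhood of $p$ in which every $q$ with $(G,q)$ strongly equivalent to $(G,p)$ is congruent to $p$. It is *minimally weakly rigid* if it is weakly rigid and no single edge or angle constraint can be removed without losing weak rigidity. It is *minimally rigid* if $A=\emptyset$, it is rigid (the same definition with edge lengths only), and no single edge can be removed without losing rigidity. It is *infinitesimally weakly rigid* if every vector in the kernel of the Jacobian at $p$ of the function listing the squared lengths of the edges and the cosines of the constrained angles is the velocity of a translation plus a rotation (plus a scaling if $E=\emptyset$). Let $(G,p)$ be minimally rigid or minimally weakly rigid. Let $\tilde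 G$ have vertex set $V\cup\{\nu\}$ with a new vertex $\nu$, and let $\tilde p$ extend $p$ by a position $\tilde p_\nu$ that is different from all $p_v$. 1. (Weakly rigid 0-extension.) Let $i\ne j$ in $V$ be such that $p_i,p_j,\tilde p_\nu$ are not collinear, and let $\tilde G$ have edge set $E$ and angle set $A\cup\{\theta^i_{j\nu},\theta^j_{i\nu}\}$. Then $(\tilde G,\tilde p)$ is minimally weakly rigid. 2. (Weakly rigid 1-extension.) Let $i,j,k\in V$ be such that $\{i,j\},\{i,k\},\{j,k\}\in E$ and $p_i,p_j,\tilde p_\nu$ are not collinear, and let $\tilde G$ have edge set $E\setminus\{\{i,j\}\}$ and angle set $A\cup\{\theta^i_{j\nu},\theta^j_{i\nu},\theta^k_{ij}\}$. Then $(\tilde G,\tilde p)$ is weakly rigid, and no angle constraint and no edge other than possibly $\{i,k\}$ and $\{j,k\}$ can be removed from it without losing weak rigidity. If moreover $(G,p)$ is infinitesimally weakly rigid, then $(\tilde G,\tilde p)$ is minimally weakly rigid. -/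

import Mathlib

open scoped EuclideanGeometry Topology

/-- The Euclidean plane. -/
abbrev Plane : Type := EuclideanSpace ℝ (Fin 2)

/-- A graph `(V, E, A)`: `graph` is the (loopless, undirected) graph of distance constraints, and
`(k, s(i, j)) ∈ angles` says that the angle at `k` subtended by `i` and `j` is constrained. The
segments `ik`, `jk` need not be edges of `graph`. -/
structure FormationGraph (V : Type*) where
  graph : SimpleGraph V
  angles : Set (V × Sym2 V)
  angles_valid : ∀ k i j, (k, s(i, j)) ∈ angles → i ≠ j ∧ i ≠ k ∧ j ≠ k

namespace FormationGraph

variable {V : Type*}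

/-- Remove the distance constraint `e`. -/
def deleteEdge (G : FormationGraph V) (e : Sym2 V) : FormationGraph V where
  graph := G.graph.deleteEdges {e}
  angles := G.angles
  angles_valid := G.angles_valid

/-- Remove the angle constraint `a`. -/
def deleteAngle (G : FormationGraph V) (a : V × Sym2 V) : FormationGraph V where
  graph := G.graph
  angles := G.angles \ {a}
  angles_valid := fun k i j h => G.angles_valid k i j h.1

/-- The frameworks `(G, p)` and `(G, q)` are equivalent: same edge lengths. -/
def Equivalent (G : FormationGraph V) (p q : V → Plane) : Prop :=
  ∀ v w, G.graph.Adj v w → dist (p v) (p w) = dist (q v) (q w)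

/-- The frameworks `(G, p)` and `(G, q)` are strongly equivalent: same edge lengths and same
constrained angles. -/
def StronglyEquivalent (G : FormationGraph V) (p q : V → Plane) : Prop :=
  (∀ v w, G.graph.Adj v w → dist (p v) (p w) = dist (q v) (q w)) ∧
    ∀ k i j, (k, s(i, j)) ∈ G.angles → ∠ (p i) (p k) (p j) = ∠ (q i) (q k) (q j)

/-- (Distance) rigidity of `(G, p)`. -/
def IsRigid (G : FormationGraph V) (p : V → Plane) : Prop :=
  ∃ U ∈ 𝓝 p, ∀ q ∈ U, G.Equivalent p q → Congruent p q

/-- Weak rigidity of `(G, p)`. -/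
def IsWeaklyRigid (G : FormationGraph V) (p : V → Plane) : Prop :=
  ∃ U ∈ 𝓝 p, ∀ q ∈ U, G.StronglyEquivalent p q → Congruent p q

/-- `(G, p)` is minimally rigid: it has distance constraints only, it is rigid, and no edge can be
removed without losing rigidity. -/
def IsMinimallyRigid (G : FormationGraph V) (p : V → Plane) : Prop :=
  G.angles = ∅ ∧ G.IsRigid p ∧ ∀ e ∈ G.graph.edgeSet, ¬ (G.deleteEdge e).IsRigid p

/-- `(G, p)` is minimally weakly rigid: it is weakly rigid and no single distance or angle
constraint can be removed without losing weak rigidity. -/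
def IsMinimallyWeaklyRigid (G : FormationGraph V) (p : V → Plane) : Prop :=
  G.IsWeaklyRigid p ∧
    (∀ e ∈ G.graph.edgeSet, ¬ (G.deleteEdge e).IsWeaklyRigid p) ∧
    ∀ a ∈ G.angles, ¬ (G.deleteAngle a).IsWeaklyRigid p

/-- `δ` is in the kernel of the weak rigidity matrix, the Jacobian at `p` of the function that lists
the squared lengths of the edges and the cosines of the constrained angles. -/
def IsInfinitesimalWeakMotion [Fintype V] (G : FormationGraph V) (p δ : V → Plane) : Prop :=
  (∀ v w, G.graph.Adj v w →
      fderiv ℝ (fun q : V → Plane => ‖q v - q w‖ ^ 2) p δ = 0) ∧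
    ∀ k i j, (k, s(i, j)) ∈ G.angles →
      fderiv ℝ (fun q : V → Plane => Real.cos (∠ (q i) (q k) (q j))) p δ = 0

/-- `δ` is the velocity of a rigid-body motion (translation and rotation), composed with a scaling
in case there are no edges. -/
def IsTrivialMotion (G : FormationGraph V) (p δ : V → Plane) : Prop :=
  ∃ (t : Plane) (ω c : ℝ), (G.graph ≠ ⊥ → c = 0) ∧
    ∀ v, δ v = t + ω • !₂[-(p v 1), p v 0] + c • p v

/-- Infinitesimal weak rigidity: all infinitesimal weak motions are trivial. -/
def IsInfinitesimallyWeaklyRigid [Fintype V] (G : FormationGraph V) (p : V → Plane) : Prop :=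
  ∀ δ : V → Plane, G.IsInfinitesimalWeakMotion p δ → G.IsTrivialMotion p δ

/-- The angle constraints of `G`, seen on the vertex set `V ∪ {ν}`, where `ν` is `none`. -/
def liftedAngles (G : FormationGraph V) : Set (Option V × Sym2 (Option V)) :=
  Prod.map some (Sym2.map some) '' G.angles

theorem liftedAngles_valid (G : FormationGraph V) (k i j : Option V)
    (h : (k, s(i, j)) ∈ G.liftedAngles) : i ≠ j ∧ i ≠ k ∧ j ≠ k := by
  obtain ⟨⟨k', e⟩, he, heq⟩ := h
  induction e using Sym2.ind with
  | _ a b =>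
    have := G.angles_valid k' a b he
    simp only [Prod.map, Sym2.map_mk, Prod.mk.injEq, Sym2.eq_iff] at heq
    obtain ⟨rfl, ⟨rfl, rfl⟩ | ⟨rfl, rfl⟩⟩ := heq
    · simpa using this
    · simpa using ⟨this.1.symm, this.2.2, this.2.1⟩

/-- The weakly rigid 0-extension: a vertex `ν = none` is added, with the two angles at `i` (between
`j` and `ν`) and at `j` (between `i` and `ν`). -/
def zeroExtension (G : FormationGraph V) (i j : V) (hij : i ≠ j) : FormationGraph (Option V) where
  graph := G.graph.map Function.Embedding.some
  angles := G.liftedAngles ∪ {(some i, s(some j, none)), (some j, s(some i, none))}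
  angles_valid := by
    rintro k a b (h | h | h)
    · exact G.liftedAngles_valid k a b h
    all_goals
      simp only [Set.mem_singleton_iff, Prod.mk.injEq, Sym2.eq_iff] at h
      obtain ⟨rfl, ⟨rfl, rfl⟩ | ⟨rfl, rfl⟩⟩ := h <;> simp [hij, hij.symm]

/-- The weakly rigid 1-extension on a triangle `ijk` of edges: the edge `ij` is removed, and a
vertex `ν = none` is added, with the three angles at `i` (between `j` and `ν`), at `j` (between `i`
and `ν`) and at `k` (between `i` and `j`). -/
def oneExtension (G : FormationGraph V) (i j k : V) (hij : G.graph.Adj i j)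
    (hik : G.graph.Adj i k) (hjk : G.graph.Adj j k) : FormationGraph (Option V) where
  graph := (G.graph.deleteEdges {s(i, j)}).map Function.Embedding.some
  angles := G.liftedAngles ∪
    {(some i, s(some j, none)), (some j, s(some i, none)), (some k, s(some i, some j))}
  angles_valid := by
    have h1 := hij.ne
    have h2 := hik.ne
    have h3 := hjk.ne
    rintro l a b (h | h | h | h)
    · exact G.liftedAngles_valid l a b h
    all_goals
      simp only [Set.mem_singleton_iff, Prod.mk.injEq, Sym2.eq_iff] at h
      obtain ⟨rfl, ⟨rfl, rfl⟩ | ⟨rfl, rfl⟩⟩ := h <;> simp [h1, h2, h3, h1.symm]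

end FormationGraph

/-- The configuration on `V ∪ {ν}` that extends `p` and puts the new vertex `ν = none` at `x`. -/
def extendConfiguration {V : Type*} (p : V → Plane) (x : Plane) : Option V → Plane :=
  fun o => o.elim x p

/-! ### Constraints as real-valued functions of a configuration -/

namespace FormationGraph

variable {V : Type*}

/-! Edges and angles are treated alike, as squared lengths and cosines; weak rigidity becomes
`Determines` for a set of such functions, and minimality says that no member can be dropped.

Attaching ν by two angles. By angle-side-angle, the triangle on p_i, p_j, ν is fixed once the rest
is fixed up to congruence. Near p no nondegenerate triangle on the base ij changes orientation, so
the distances from ν to all other vertices are fixed too (`determines_extendConfiguration`).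
Conversely, a flex of the old framework extends to ν by keeping its coordinates in the frame spanned
by i and j, a similarity that preserves both angles (`not_determines_extendConfiguration`). With
only one of the two angles, ν slides along a ray (`not_determines_of_single_angle`). This settles
the 0-extension.

For the 1-extension, the law of cosines lets the angle at k stand in for the edge ij as long as ik
and jk are present, which gives weak rigidity and every removal except those of ik and jk. For these
two, infinitesimal rigidity and minimality make the rows of the Jacobian independent
(`range_fderiv_eq_top`): otherwise a redundant row could be dropped and the remaining constraints
would still determine p. The measurement map is then open at p, so the lengths of ij and ik can be
varied with the angle at k and all other constraints fixed (`not_determines_of_range_eq_top`). -/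

/-- The squared length of the segment `e` in the configuration `q`. -/
noncomputable def sqLength (e : Sym2 V) (q : V → Plane) : ℝ :=
  Sym2.lift ⟨fun v w => ‖q v - q w‖ ^ 2, fun v w => by simp only [norm_sub_rev]⟩ e

/-- The cosine of the angle `a` in the configuration `q`. -/
noncomputable def cosAngle (a : V × Sym2 V) (q : V → Plane) : ℝ :=
  Sym2.lift ⟨fun i j => Real.cos (∠ (q i) (q a.1) (q j)),
    fun i j => by simp only [EuclideanGeometry.angle_comm]⟩ a.2

/-- The value of a distance or angle constraint: squared length or cosine. -/
noncomputable def measure (c : Sym2 V ⊕ V × Sym2 V) (q : V → Plane) : ℝ :=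
  c.elim (fun e => sqLength e q) (fun a => cosAngle a q)

@[simp]
theorem measure_inl (v w : V) (q : V → Plane) :
    measure (.inl s(v, w)) q = ‖q v - q w‖ ^ 2 := rfl

@[simp]
theorem measure_inr (k i j : V) (q : V → Plane) :
    measure (.inr (k, s(i, j))) q = Real.cos (∠ (q i) (q k) (q j)) := rfl

theorem measure_inl_eq_iff {v w : V} {p q : V → Plane} :
    measure (.inl s(v, w)) p = measure (.inl s(v, w)) q ↔
      dist (p v) (p w) = dist (q v) (q w) := by
  rw [measure_inl, measure_inl, ← dist_eq_norm, ← dist_eq_norm, sq_eq_sq₀ dist_nonneg dist_nonneg]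

theorem measure_inr_eq_iff {k i j : V} {p q : V → Plane} :
    measure (.inr (k, s(i, j))) p = measure (.inr (k, s(i, j))) q ↔
      ∠ (p i) (p k) (p j) = ∠ (q i) (q k) (q j) :=
  ⟨fun h => Real.injOn_cos ⟨EuclideanGeometry.angle_nonneg _ _ _, EuclideanGeometry.angle_le_pi _ _ _⟩
    ⟨EuclideanGeometry.angle_nonneg _ _ _, EuclideanGeometry.angle_le_pi _ _ _⟩ h,
    fun h => by simp [h]⟩

/-- All distance and angle constraints of `G`. -/
def constraints (G : FormationGraph V) : Set (Sym2 V ⊕ V × Sym2 V) :=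
  Sum.inl '' G.graph.edgeSet ∪ Sum.inr '' G.angles

@[simp]
theorem inl_mem_constraints {G : FormationGraph V} {e : Sym2 V} :
    .inl e ∈ G.constraints ↔ e ∈ G.graph.edgeSet := by
  simp [constraints]

@[simp]
theorem inr_mem_constraints {G : FormationGraph V} {a : V × Sym2 V} :
    .inr a ∈ G.constraints ↔ a ∈ G.angles := by
  simp [constraints]

/-- The configurations `p` and `q` give the same value to all constraints in `S`. -/
def AgreeOn (S : Set (Sym2 V ⊕ V × Sym2 V)) (p q : V → Plane) : Prop :=
  ∀ c ∈ S, measure c p = measure c q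

/-- The constraints in `S` determine the configuration `p` locally up to congruence. -/
def Determines (S : Set (Sym2 V ⊕ V × Sym2 V)) (p : V → Plane) : Prop :=
  ∀ᶠ q in 𝓝 p, AgreeOn S p q → Congruent p q

theorem not_determines_iff {S : Set (Sym2 V ⊕ V × Sym2 V)} {p : V → Plane} :
    ¬ Determines S p ↔ ∃ᶠ q in 𝓝 p, AgreeOn S p q ∧ ¬ Congruent p q := by
  simp [Determines, Filter.not_eventually]

theorem AgreeOn.mono {S T : Set (Sym2 V ⊕ V × Sym2 V)} {p q : V → Plane} (h : AgreeOn T p q)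
    (hST : S ⊆ T) : AgreeOn S p q :=
  fun c hc => h c (hST hc)

theorem agreeOn_constraints_iff {G : FormationGraph V} {p q : V → Plane} :
    AgreeOn G.constraints p q ↔ G.StronglyEquivalent p q := by
  constructor
  · intro h
    exact ⟨fun v w hvw => measure_inl_eq_iff.1 (h _ (by simpa using hvw)),
      fun k i j ha => measure_inr_eq_iff.1 (h _ (by simpa using ha))⟩
  · rintro ⟨h₁, h₂⟩ (e | ⟨k, e⟩) hc
    · induction e using Sym2.ind with
      | _ v w => exact measure_inl_eq_iff.2 (h₁ v w (by simpa using hc))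
    · induction e using Sym2.ind with
      | _ i j => exact measure_inr_eq_iff.2 (h₂ k i j (by simpa using hc))

theorem isWeaklyRigid_iff {G : FormationGraph V} {p : V → Plane} :
    G.IsWeaklyRigid p ↔ Determines G.constraints p := by
  simp only [IsWeaklyRigid, Determines, agreeOn_constraints_iff, Filter.eventually_iff_exists_mem]

theorem constraints_deleteEdge (G : FormationGraph V) (e : Sym2 V) :
    (G.deleteEdge e).constraints = G.constraints \ {.inl e} := by
  ext (c | c) <;> simp [deleteEdge]

theorem constraints_deleteAngle (G : FormationGraph V) (a : V × Sym2 V) :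
    (G.deleteAngle a).constraints = G.constraints \ {.inr a} := by
  ext (c | c) <;> simp [deleteAngle]

theorem isMinimallyWeaklyRigid_iff {G : FormationGraph V} {p : V → Plane} :
    G.IsMinimallyWeaklyRigid p ↔ Determines G.constraints p ∧
      ∀ c ∈ G.constraints, ¬ Determines (G.constraints \ {c}) p := by
  simp only [IsMinimallyWeaklyRigid, isWeaklyRigid_iff, constraints_deleteEdge,
    constraints_deleteAngle, Sum.forall, inl_mem_constraints, inr_mem_constraints]

theorem isRigid_iff_isWeaklyRigid {G : FormationGraph V} {p : V → Plane} (h : G.angles = ∅) :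
    G.IsRigid p ↔ G.IsWeaklyRigid p := by
  simp [IsRigid, IsWeaklyRigid, Equivalent, StronglyEquivalent, h]

theorem IsMinimallyRigid.isMinimallyWeaklyRigid {G : FormationGraph V} {p : V → Plane}
    (h : G.IsMinimallyRigid p) : G.IsMinimallyWeaklyRigid p := by
  obtain ⟨h₁, h₂, h₃⟩ := h
  refine ⟨(isRigid_iff_isWeaklyRigid h₁).1 h₂, fun e he => ?_, by simp [h₁]⟩
  rw [← isRigid_iff_isWeaklyRigid (G := G.deleteEdge e) h₁]
  exact h₃ e he

/-! ### Constraint sets of the two extensions -/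

/-- The constraint `c`, seen on the vertex set `V ∪ {ν}`. -/
def liftConstraint : Sym2 V ⊕ V × Sym2 V → Sym2 (Option V) ⊕ Option V × Sym2 (Option V) :=
  Sum.map (Sym2.map some) (Prod.map some (Sym2.map some))

@[simp]
theorem liftConstraint_inl (v w : V) :
    liftConstraint (.inl s(v, w)) = .inl s(some v, some w) := rfl

@[simp]
theorem liftConstraint_inr (k i j : V) :
    liftConstraint (.inr (k, s(i, j))) = .inr (some k, s(some i, some j)) := rfl

theorem measure_liftConstraint (c : Sym2 V ⊕ V × Sym2 V) (q : Option V → Plane) :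
    measure (liftConstraint c) q = measure c (q ∘ some) := by
  obtain e | ⟨k, e⟩ := c
  all_goals
    induction e using Sym2.ind with
    | _ v w => rfl

theorem agreeOn_image_liftConstraint {S : Set (Sym2 V ⊕ V × Sym2 V)} {p q : Option V → Plane} :
    AgreeOn (liftConstraint '' S) p q ↔ AgreeOn S (p ∘ some) (q ∘ some) := by
  simp only [AgreeOn, Set.forall_mem_image, measure_liftConstraint]

/-- The two angle constraints that attach the new vertex to the vertices `i` and `j`. -/
def newAngles (i j : V) : Set (Sym2 (Option V) ⊕ Option V × Sym2 (Option V)) :=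
  {.inr (some i, s(some j, none)), .inr (some j, s(some i, none))}

theorem newAngles_comm (i j : V) : newAngles i j = newAngles j i :=
  Set.pair_comm _ _

theorem constraints_zeroExtension (G : FormationGraph V) {i j : V} (hij : i ≠ j) :
    (G.zeroExtension i j hij).constraints = liftConstraint '' G.constraints ∪ newAngles i j := by
  simp only [constraints, zeroExtension, SimpleGraph.edgeSet_map, newAngles, liftedAngles,
    Set.image_union, Set.image_image, Set.image_pair, Set.union_assoc]
  rfl

theorem constraints_oneExtension (G : FormationGraph V) {i j k : V} (hij : G.graph.Adj i j)
    (hik : G.graph.Adj i k) (hjk : G.graph.Adj j k) :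
    (G.oneExtension i j k hij hik hjk).constraints =
      liftConstraint '' (G.constraints \ {.inl s(i, j)} ∪ {.inr (k, s(i, j))}) ∪ newAngles i j := by
  have h : G.constraints \ {.inl s(i, j)} =
      Sum.inl '' (G.graph.edgeSet \ {s(i, j)}) ∪ Sum.inr '' G.angles := by
    ext (c | c) <;> simp [constraints]
  rw [h]
  simp only [constraints, oneExtension, SimpleGraph.edgeSet_map, SimpleGraph.edgeSet_deleteEdges,
    newAngles, liftedAngles, Set.image_union, Set.image_image, Set.image_singleton,
    Set.image_insert_eq, liftConstraint_inr]
  ext c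
  simp only [Set.mem_union, Set.mem_insert_iff, Set.mem_singleton_iff]
  change (c ∈ (fun x => liftConstraint (Sum.inl x)) '' (G.graph.edgeSet \ {s(i, j)}) ∨
    c ∈ (fun x => liftConstraint (Sum.inr x)) '' G.angles ∨ _ ∨ _ ∨ _) ↔ _
  tauto

end FormationGraph

/-! ### Coordinates and orientation in the plane -/

namespace Plane

/-- Rotation of the plane by a right angle. -/
noncomputable def rot (a : Plane) : Plane := !₂[-(a 1), a 0]

@[simp] theorem rot_apply_zero (a : Plane) : rot a 0 = -(a 1) := rfl

@[simp] theorem rot_apply_one (a : Plane) : rot a 1 = a 0 := rfl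

/-- The determinant of two vectors of the plane. -/
def det (a b : Plane) : ℝ := a 0 * b 1 - a 1 * b 0

@[ext]
theorem ext' {a b : Plane} (h₀ : a 0 = b 0) (h₁ : a 1 = b 1) : a = b := by
  ext i
  fin_cases i
  exacts [h₀, h₁]

theorem norm_sq (a : Plane) : ‖a‖ ^ 2 = a 0 ^ 2 + a 1 ^ 2 := by
  simp [EuclideanSpace.norm_sq_eq, Fin.sum_univ_two]

theorem dist_sq (a b : Plane) : dist a b ^ 2 = (a 0 - b 0) ^ 2 + (a 1 - b 1) ^ 2 := by
  rw [dist_eq_norm, norm_sq]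
  simp

theorem inner_eq (a b : Plane) : inner ℝ a b = a 0 * b 0 + a 1 * b 1 := by
  simp [PiLp.inner_apply, Fin.sum_univ_two, mul_comm]

theorem sq_add_sq_pos {a b : Plane} (h : a ≠ b) : 0 < (b 0 - a 0) ^ 2 + (b 1 - a 1) ^ 2 := by
  rw [← dist_sq]
  have := dist_pos.2 h.symm
  positivity

/-- The point with coordinates `(α, β)` in the frame with origin `a` and unit point `b`. -/
noncomputable def place (α β : ℝ) (a b : Plane) : Plane := a + α • (b - a) + β • rot (b - a)

theorem place_apply_zero (α β : ℝ) (a b : Plane) :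
    place α β a b 0 = a 0 + α * (b 0 - a 0) - β * (b 1 - a 1) := by
  simp [place]
  ring

theorem place_apply_one (α β : ℝ) (a b : Plane) :
    place α β a b 1 = a 1 + α * (b 1 - a 1) + β * (b 0 - a 0) := by
  simp [place]

/-- Exchanging the ends of the base reduces the angle at the second end to the one at the first. -/
theorem place_swap (α β : ℝ) (a b : Plane) : place (1 - α) (-β) b a = place α β a b := by
  apply ext'
  · simp only [place_apply_zero]
    ring
  · simp only [place_apply_one]
    ring

theorem exists_eq_place {a b : Plane} (h : a ≠ b) (x : Plane) : ∃ α β : ℝ, x = place α β a b := by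
  have := (sq_add_sq_pos h).ne'
  refine ⟨((x 0 - a 0) * (b 0 - a 0) + (x 1 - a 1) * (b 1 - a 1)) /
    ((b 0 - a 0) ^ 2 + (b 1 - a 1) ^ 2), ((x 1 - a 1) * (b 0 - a 0) - (x 0 - a 0) * (b 1 - a 1)) /
    ((b 0 - a 0) ^ 2 + (b 1 - a 1) ^ 2), ext' ?_ ?_⟩
  · rw [place_apply_zero]
    field_simp
    ring
  · rw [place_apply_one]
    field_simp
    ring

/-- The value does not involve the base points: the frame changes by a similarity when they move. -/
theorem cos_angle_place {a b : Plane} (h : a ≠ b) (α β : ℝ) :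
    Real.cos (∠ b a (place α β a b)) = α / √(α ^ 2 + β ^ 2) := by
  have hu : 0 < ‖b - a‖ := norm_pos_iff.2 (sub_ne_zero.2 h.symm)
  have h₁ : inner ℝ (b - a) (place α β a b - a) = α * ‖b - a‖ ^ 2 := by
    rw [inner_eq, norm_sq]
    simp only [PiLp.sub_apply, place_apply_zero, place_apply_one]
    ring
  have h₂ : ‖place α β a b - a‖ = √(α ^ 2 + β ^ 2) * ‖b - a‖ := by
    rw [← sq_eq_sq₀ (norm_nonneg _) (by positivity), mul_pow, Real.sq_sqrt (by positivity), norm_sq,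
      norm_sq]
    simp only [PiLp.sub_apply, place_apply_zero, place_apply_one]
    ring
  rw [EuclideanGeometry.angle, InnerProductGeometry.cos_angle, vsub_eq_sub, vsub_eq_sub, h₁, h₂,
    mul_left_comm, ← sq, mul_div_mul_right _ _ (by positivity)]

theorem continuous_rot : Continuous rot := by
  unfold rot
  fun_prop

/-- If the distances of `y` and `z` to `a` and `b ≠ a` agree with those of `y'` and `z'` to `a'`
and `b'`, and the orientations of the triangles agree, then the distance of `y` and `z` agrees with
that of `y'` and `z'`. -/
theorem dist_eq_of_dist_eq_of_det {a b y z a' b' y' z' : Plane} (h : a ≠ b)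
    (hab : dist a b = dist a' b') (hay : dist a y = dist a' y') (hby : dist b y = dist b' y')
    (haz : dist a z = dist a' z') (hbz : dist b z = dist b' z')
    (hy : det (b - a) (y - a) ≠ 0 → 0 < det (b - a) (y - a) * det (b' - a') (y' - a'))
    (hz : det (b - a) (z - a) ≠ 0 → 0 < det (b - a) (z - a) * det (b' - a') (z' - a')) :
    dist y z = dist y' z' := by
  have sq_dist : ∀ {s t s' t' : Plane}, dist s t = dist s' t' →
      (s 0 - t 0) ^ 2 + (s 1 - t 1) ^ 2 = (s' 0 - t' 0) ^ 2 + (s' 1 - t' 1) ^ 2 := by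
    intro s t s' t' hst
    rw [← dist_sq, hst, dist_sq]
  have key : ∀ {s s' : Plane}, dist a s = dist a' s' → dist b s = dist b' s' →
      (det (b - a) (s - a) ≠ 0 → 0 < det (b - a) (s - a) * det (b' - a') (s' - a')) →
      (b 0 - a 0) * (s 0 - a 0) + (b 1 - a 1) * (s 1 - a 1) =
        (b' 0 - a' 0) * (s' 0 - a' 0) + (b' 1 - a' 1) * (s' 1 - a' 1) ∧
      det (b - a) (s - a) = det (b' - a') (s' - a') := by
    intro s s' h₁ h₂ h₃
    have e₀ := sq_dist hab
    have e₁ := sq_dist h₁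
    have e₂ := sq_dist h₂
    have hdot : (b 0 - a 0) * (s 0 - a 0) + (b 1 - a 1) * (s 1 - a 1) =
        (b' 0 - a' 0) * (s' 0 - a' 0) + (b' 1 - a' 1) * (s' 1 - a' 1) := by
      linear_combination (e₀ + e₁ - e₂) / 2
    refine ⟨hdot, ?_⟩
    -- Lagrange's identity: lengths and inner product give the determinant up to sign. The
    -- orientation hypothesis then selects the sign.
    have hsq : det (b - a) (s - a) ^ 2 = det (b' - a') (s' - a') ^ 2 := by
      have e₃ : ∀ a b s : Plane, det (b - a) (s - a) ^ 2 =
          ((a 0 - b 0) ^ 2 + (a 1 - b 1) ^ 2) * ((a 0 - s 0) ^ 2 + (a 1 - s 1) ^ 2) -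
          ((b 0 - a 0) * (s 0 - a 0) + (b 1 - a 1) * (s 1 - a 1)) ^ 2 := by
        intro a b s
        simp only [det, PiLp.sub_apply]
        ring
      rw [e₃, e₃, e₀, e₁, hdot]
    rcases sq_eq_sq_iff_eq_or_eq_neg.1 hsq with h₄ | h₄
    · exact h₄
    · by_cases h₅ : det (b - a) (s - a) = 0
      · rw [h₅] at hsq ⊢
        exact (pow_eq_zero_iff two_ne_zero).1 (by simpa using hsq.symm) |>.symm
      · have := h₃ h₅
        nlinarith [sq_nonneg (det (b' - a') (s' - a'))]
  obtain ⟨hy₁, hy₂⟩ := key hay hby hy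
  obtain ⟨hz₁, hz₂⟩ := key haz hbz hz
  have e₁ := sq_dist hay
  have e₂ := sq_dist haz
  -- Expands the inner product of y - a and z - a in the orthogonal frame of b - a and its rotation
  -- by a right angle.
  have e₃ : ∀ a b y z : Plane, ((a 0 - b 0) ^ 2 + (a 1 - b 1) ^ 2) *
      ((y 0 - a 0) * (z 0 - a 0) + (y 1 - a 1) * (z 1 - a 1)) =
      ((b 0 - a 0) * (y 0 - a 0) + (b 1 - a 1) * (y 1 - a 1)) *
      ((b 0 - a 0) * (z 0 - a 0) + (b 1 - a 1) * (z 1 - a 1)) +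
      det (b - a) (y - a) * det (b - a) (z - a) := by
    intro a b y z
    simp only [det, PiLp.sub_apply]
    ring
  have hinner : (y 0 - a 0) * (z 0 - a 0) + (y 1 - a 1) * (z 1 - a 1) =
      (y' 0 - a' 0) * (z' 0 - a' 0) + (y' 1 - a' 1) * (z' 1 - a' 1) := by
    have h₆ := e₃ a b y z
    rw [hy₁, hz₁, hy₂, hz₂, ← e₃, ← sq_dist hab] at h₆
    refine mul_left_cancel₀ ?_ h₆
    rw [← dist_sq]
    exact pow_ne_zero 2 (dist_ne_zero.2 h)
  rw [← sq_eq_sq₀ dist_nonneg dist_nonneg, dist_sq, dist_sq]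
  linear_combination e₁ + e₂ - 2 * hinner

end Plane

/-! ### Attaching the new vertex: determination and flexes -/

namespace FormationGraph

variable {V : Type*}

theorem extendConfiguration_comp_some (p : V → Plane) (x : Plane) :
    extendConfiguration p x ∘ some = p := rfl

theorem eventually_det_pos (p : V → Plane) (i j l : V) :
    ∀ᶠ q in 𝓝 p, Plane.det (p j - p i) (p l - p i) ≠ 0 →
      0 < Plane.det (p j - p i) (p l - p i) * Plane.det (q j - q i) (q l - q i) := by
  by_cases h : Plane.det (p j - p i) (p l - p i) = 0
  · simp [h]
  · have hc : Continuous fun q : V → Plane =>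
        Plane.det (p j - p i) (p l - p i) * Plane.det (q j - q i) (q l - q i) := by
      unfold Plane.det
      fun_prop
    filter_upwards [hc.continuousAt.eventually_const_lt (mul_self_pos.2 h)] with q hq _ using hq

/-- Two angles attach a new vertex rigidly. -/
theorem determines_extendConfiguration [Finite V] {p : V → Plane} {x : Plane} {i j : V}
    {S : Set (Sym2 V ⊕ V × Sym2 V)} {T : Set (Sym2 (Option V) ⊕ Option V × Sym2 (Option V))}
    (hx : AffineIndependent ℝ ![p i, p j, x]) (hT : newAngles i j ⊆ T) (hS : Determines S p)
    (hST : ∀ q, AgreeOn T (extendConfiguration p x) q → AgreeOn S p (q ∘ some)) :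
    Determines T (extendConfiguration p x) := by
  have hcol : ¬ Collinear ℝ {x, p i, p j} := by
    rw [Set.insert_comm, Set.pair_comm]
    exact affineIndependent_iff_not_collinear_set.1 hx
  have hij : p i ≠ p j := hx.injective.ne (show (0 : Fin 3) ≠ 1 by decide)
  have hcont : Filter.Tendsto (fun q : Option V → Plane => q ∘ some)
      (𝓝 (extendConfiguration p x)) (𝓝 p) :=
    Continuous.tendsto' (by fun_prop) _ _ rfl
  have hdet : ∀ᶠ q in 𝓝 (extendConfiguration p x), ∀ l : Option V,
      Plane.det (p j - p i) (extendConfiguration p x l - p i) ≠ 0 →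
        0 < Plane.det (p j - p i) (extendConfiguration p x l - p i) *
          Plane.det (q (some j) - q (some i)) (q l - q (some i)) :=
    Filter.eventually_all.2 fun l => eventually_det_pos (extendConfiguration p x) (some i) (some j) l
  have hnear := hcont.eventually hS
  filter_upwards [hnear, hdet] with q hq hdet hagree
  have hc : ∀ v w : V, dist (p v) (p w) = dist (q (some v)) (q (some w)) :=
    congruent_iff_dist_eq.1 (hq (hST q hagree))
  have hi := measure_inr_eq_iff.1
    (hagree (.inr (some i, s(some j, none))) (hT (by simp [newAngles])))
  have hj := measure_inr_eq_iff.1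
    (hagree (.inr (some j, s(some i, none))) (hT (by simp [newAngles])))
  change ∠ (p j) (p i) x = _ at hi
  change ∠ (p i) (p j) x = _ at hj
  have htri : Congruent ![x, p i, p j] ![q none, q (some i), q (some j)] := by
    refine EuclideanGeometry.angle_side_angle hcol ?_ (hc i j) hj
    rw [EuclideanGeometry.angle_comm, hi, EuclideanGeometry.angle_comm]
  have hxi : dist (p i) x = dist (q (some i)) (q none) := by
    simpa using htri.dist_eq 1 0
  have hxj : dist (p j) x = dist (q (some j)) (q none) := by
    simpa using htri.dist_eq 2 0
  -- The triangles on the base ij with apexes v and ν keep their side lengths and, near p, their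
  -- orientations.
  have hv : ∀ v, dist (p v) x = dist (q (some v)) (q none) := fun v =>
    Plane.dist_eq_of_dist_eq_of_det hij (hc i j)
      (hc i v) (hc j v) hxi hxj (hdet (some v)) (hdet none)
  rw [congruent_iff_dist_eq]
  rintro (_ | v) (_ | w)
  · simp
  · rw [dist_comm, dist_comm (q none)]
    exact hv w
  · exact hv v
  · exact hc v w

theorem agreeOn_newAngles {p q : Option V → Plane} {i j : V} {α β : ℝ}
    (hp : p (some i) ≠ p (some j)) (hq : q (some i) ≠ q (some j))
    (hp' : p none = Plane.place α β (p (some i)) (p (some j)))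
    (hq' : q none = Plane.place α β (q (some i)) (q (some j))) :
    AgreeOn (newAngles i j) p q := by
  rintro c (rfl | rfl)
  · rw [measure_inr, measure_inr, hp', hq', Plane.cos_angle_place hp, Plane.cos_angle_place hq]
  · rw [measure_inr, measure_inr, hp', hq', ← Plane.place_swap, ← Plane.place_swap α,
      Plane.cos_angle_place hp.symm, Plane.cos_angle_place hq.symm]

/-- A flex of the old framework extends to the new vertex. -/
theorem not_determines_extendConfiguration {p : V → Plane} {i j : V} (hij : p i ≠ p j) (x : Plane)
    {S : Set (Sym2 V ⊕ V × Sym2 V)} {T : Set (Sym2 (Option V) ⊕ Option V × Sym2 (Option V))}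
    (hS : ¬ Determines S p) (hT : T ⊆ liftConstraint '' S ∪ newAngles i j) :
    ¬ Determines T (extendConfiguration p x) := by
  obtain ⟨α, β, hx⟩ := Plane.exists_eq_place hij x
  have hne : ∀ᶠ q in 𝓝 p, q i ≠ q j :=
    (isOpen_ne_fun (continuous_apply i) (continuous_apply j)).mem_nhds hij
  -- The new vertex follows i and j with its frame coordinates α and β held constant.
  have hcont : Filter.Tendsto
      (fun q : V → Plane => extendConfiguration q (Plane.place α β (q i) (q j)))
      (𝓝 p) (𝓝 (extendConfiguration p x)) := by
    refine Continuous.tendsto' (continuous_pi ?_) _ _ (by rw [hx])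
    rintro (_ | v)
    · change Continuous fun q : V → Plane => Plane.place α β (q i) (q j)
      have := Plane.continuous_rot
      unfold Plane.place
      fun_prop
    · exact continuous_apply v
  rw [not_determines_iff] at hS ⊢
  refine hcont.frequently ((hS.and_eventually hne).mono ?_)
  rintro q ⟨⟨hq, hq'⟩, hne⟩
  refine ⟨fun c hc => ?_, fun hcong => hq' (hcong.index_map some)⟩
  rcases hT hc with ⟨c, hcS, rfl⟩ | hc
  · rw [measure_liftConstraint, measure_liftConstraint]
    exact hq c hcS
  · exact agreeOn_newAngles hij hne hx rfl c hc

/-- A single angle does not attach the new vertex rigidly. -/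
theorem not_determines_of_single_angle {p : V → Plane} {x : Plane} {i j : V} (hx : x ≠ p j)
    {S : Set (Sym2 V ⊕ V × Sym2 V)} {T : Set (Sym2 (Option V) ⊕ Option V × Sym2 (Option V))}
    (hT : T ⊆ liftConstraint '' S ∪ {.inr (some j, s(some i, none))}) :
    ¬ Determines T (extendConfiguration p x) := by
  -- Sliding ν along the ray from p_j keeps the angle at j. The value t = 1 is excluded so that the
  -- distance to p_j really changes.
  have hcont : Filter.Tendsto (fun t : ℝ => extendConfiguration p (p j + t • (x - p j)))
      (𝓝[≠] 1) (𝓝 (extendConfiguration p x)) := by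
    refine Filter.Tendsto.mono_left (Continuous.tendsto' (continuous_pi ?_) _ _ ?_)
      nhdsWithin_le_nhds
    · rintro (_ | v)
      · change Continuous fun t : ℝ => p j + t • (x - p j)
        fun_prop
      · exact continuous_const
    · simp
  rw [not_determines_iff]
  refine hcont.frequently (Filter.Eventually.frequently ?_)
  filter_upwards [nhdsWithin_le_nhds (lt_mem_nhds (zero_lt_one (α := ℝ))), self_mem_nhdsWithin]
    with t ht ht'
  refine ⟨fun c hc => ?_, fun hcong => ht' ?_⟩
  · rcases hT hc with ⟨c, -, rfl⟩ | rfl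
    · rw [measure_liftConstraint, measure_liftConstraint]
      rfl
    · rw [measure_inr_eq_iff]
      change InnerProductGeometry.angle (p i - p j) (x - p j) =
        InnerProductGeometry.angle (p i - p j) (p j + t • (x - p j) - p j)
      rw [add_sub_cancel_left, InnerProductGeometry.angle_smul_right_of_pos _ _ ht]
  · have h := hcong.dist_eq (some j) none
    change dist (p j) x = dist (p j) (p j + t • (x - p j)) at h
    rw [dist_self_add_right, norm_smul, dist_eq_norm', Real.norm_of_nonneg ht.le] at h
    exact mul_right_cancel₀ (norm_ne_zero_iff.2 (sub_ne_zero.2 hx)) (by rw [one_mul, ← h])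

/-! ### Law of cosines and differentiability of the constraints -/

/-- The law of cosines. No nondegeneracy is needed: if i or j coincides with k, the angle is π/2 by
convention and the division by zero also gives 0. -/
theorem measure_inr_eq (k i j : V) (q : V → Plane) :
    measure (.inr (k, s(i, j))) q =
      (measure (.inl s(i, k)) q + measure (.inl s(j, k)) q - measure (.inl s(i, j)) q) / 2 /
        (√(measure (.inl s(i, k)) q) * √(measure (.inl s(j, k)) q)) := by
  simp only [measure_inr, measure_inl, Real.sqrt_sq (norm_nonneg _)]
  rw [EuclideanGeometry.angle, InnerProductGeometry.cos_angle, vsub_eq_sub, vsub_eq_sub,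
    real_inner_eq_norm_mul_self_add_norm_mul_self_sub_norm_sub_mul_self_div_two,
    sub_sub_sub_cancel_right]
  simp only [sq]

theorem measure_inl_eq (k i j : V) (q : V → Plane) :
    measure (.inl s(i, j)) q =
      measure (.inl s(i, k)) q + measure (.inl s(j, k)) q -
        2 * (√(measure (.inl s(i, k)) q) * √(measure (.inl s(j, k)) q)) *
          measure (.inr (k, s(i, j))) q := by
  simp only [measure_inr, measure_inl, Real.sqrt_sq (norm_nonneg _)]
  have h := InnerProductGeometry.cos_angle_mul_norm_mul_norm (q i - q k) (q j - q k)
  rw [real_inner_eq_norm_mul_self_add_norm_mul_self_sub_norm_sub_mul_self_div_two,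
    sub_sub_sub_cancel_right] at h
  change _ = _ - _ * Real.cos (InnerProductGeometry.angle (q i - q k) (q j - q k))
  linear_combination 2 * h

theorem measure_eq_of_congruent {p q : V → Plane} (h : Congruent p q)
    (c : Sym2 V ⊕ V × Sym2 V) : measure c p = measure c q := by
  obtain e | ⟨k, e⟩ := c
  all_goals
    induction e using Sym2.ind with
    | _ v w => ?_
  · exact measure_inl_eq_iff.2 (h.dist_eq v w)
  · exact measure_inr_eq_iff.2 (EuclideanGeometry.angle_eq_of_congruent h v k w)

theorem hasStrictFDerivAt_sqLength (v w : V) [Fintype V] (p : V → Plane) :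
    HasStrictFDerivAt (measure (.inl s(v, w))) (fderiv ℝ (measure (.inl s(v, w))) p) p := by
  have h : ContDiff ℝ 1 fun q : V → Plane => ‖q v - q w‖ ^ 2 :=
    ContDiff.norm_sq ℝ (by fun_prop)
  exact h.contDiffAt.hasStrictFDerivAt one_ne_zero

theorem hasStrictFDerivAt_cosAngle [Fintype V] {k i j : V} {p : V → Plane} (hi : p i ≠ p k)
    (hj : p j ≠ p k) :
    HasStrictFDerivAt (measure (.inr (k, s(i, j)))) (fderiv ℝ (measure (.inr (k, s(i, j)))) p) p := by
  have hi' := sub_ne_zero.2 hi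
  have hj' := sub_ne_zero.2 hj
  have h : ContDiffAt ℝ 1 (fun q : V → Plane =>
      inner ℝ (q i - q k) (q j - q k) / (‖q i - q k‖ * ‖q j - q k‖)) p := by
    refine ContDiffAt.div (ContDiffAt.inner ℝ (by fun_prop) (by fun_prop)) (ContDiffAt.mul ?_ ?_) (by positivity)
    · exact ContDiffAt.norm ℝ (by fun_prop) hi'
    · exact ContDiffAt.norm ℝ (by fun_prop) hj'
  have heq : measure (.inr (k, s(i, j))) = fun q : V → Plane =>
      inner ℝ (q i - q k) (q j - q k) / (‖q i - q k‖ * ‖q j - q k‖) :=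
    funext fun q => InnerProductGeometry.cos_angle _ _
  rw [← heq] at h
  exact h.hasStrictFDerivAt one_ne_zero

/-- Strictness is what the open mapping argument needs. Injectivity keeps the arms of each angle
nonzero, where the cosine is smooth. -/
theorem hasStrictFDerivAt_measure [Fintype V] {G : FormationGraph V} {p : V → Plane}
    (hp : Function.Injective p) {c : Sym2 V ⊕ V × Sym2 V} (hc : c ∈ G.constraints) :
    HasStrictFDerivAt (measure c) (fderiv ℝ (measure c) p) p := by
  obtain e | ⟨k, e⟩ := c
  all_goals
    induction e using Sym2.ind with
    | _ v w => ?_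
  · exact hasStrictFDerivAt_sqLength v w p
  · obtain ⟨-, h₁, h₂⟩ := G.angles_valid k v w (by simpa using hc)
    exact hasStrictFDerivAt_cosAngle (hp.ne h₁) (hp.ne h₂)

theorem isInfinitesimalWeakMotion_iff [Fintype V] {G : FormationGraph V} {p δ : V → Plane} :
    G.IsInfinitesimalWeakMotion p δ ↔ ∀ c ∈ G.constraints, fderiv ℝ (measure c) p δ = 0 := by
  constructor
  · rintro ⟨h₁, h₂⟩ (e | ⟨k, e⟩) hc
    all_goals
      induction e using Sym2.ind with
      | _ v w => ?_
    · exact h₁ v w (by simpa using hc)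
    · exact h₂ k v w (by simpa using hc)
  · intro h
    exact ⟨fun v w hvw => h (.inl s(v, w)) (by simpa using hvw),
      fun k i j ha => h (.inr (k, s(i, j))) (by simpa using ha)⟩

/-! ### From infinitesimal to local rigidity -/

/-- The configuration `q`, moved rigidly so that vertex `i` is at `p i` and vertex `k` is on the
line through `p i` and `p k`. -/
noncomputable def normalize (p : V → Plane) (i k : V) (q : V → Plane) : V → Plane := fun v =>
  p i + (inner ℝ (q k - q i) (p k - p i) / (‖p k - p i‖ * ‖q k - q i‖)) • (q v - q i) +
    (Plane.det (q k - q i) (p k - p i) / (‖p k - p i‖ * ‖q k - q i‖)) • Plane.rot (q v - q i)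

theorem normalize_self {p : V → Plane} {i k : V} (h : p i ≠ p k) : normalize p i k p = p := by
  have h₁ : ‖p k - p i‖ ≠ 0 := norm_ne_zero_iff.2 (sub_ne_zero.2 h.symm)
  have h₂ : Plane.det (p k - p i) (p k - p i) = 0 := by
    unfold Plane.det
    ring
  funext v
  rw [normalize, h₂, real_inner_self_eq_norm_mul_norm, div_self (mul_ne_zero h₁ h₁)]
  simp

theorem continuousAt_normalize {p : V → Plane} {i k : V} (h : p i ≠ p k) :
    ContinuousAt (normalize p i k) p := by
  have h₀ : ‖p k - p i‖ ≠ 0 := norm_ne_zero_iff.2 (sub_ne_zero.2 h.symm)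
  have hrot := Plane.continuous_rot
  have h₁ : ContinuousAt (fun q : V → Plane =>
      inner ℝ (q k - q i) (p k - p i) / (‖p k - p i‖ * ‖q k - q i‖)) p :=
    ContinuousAt.div (by fun_prop) (by fun_prop) (mul_ne_zero h₀ h₀)
  have h₂ : ContinuousAt (fun q : V → Plane =>
      Plane.det (q k - q i) (p k - p i) / (‖p k - p i‖ * ‖q k - q i‖)) p :=
    ContinuousAt.div (by unfold Plane.det; fun_prop) (by fun_prop) (mul_ne_zero h₀ h₀)
  refine continuousAt_pi.2 fun v => ?_
  have h₃ : ContinuousAt (fun q : V → Plane => q v - q i) p := by fun_prop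
  have h₄ : ContinuousAt (fun q : V → Plane => Plane.rot (q v - q i)) p := by fun_prop
  exact (continuousAt_const.add (h₁.smul h₃)).add (h₂.smul h₄)

theorem inner_sq_add_det_sq (a b : Plane) :
    inner ℝ a b ^ 2 + Plane.det a b ^ 2 = (‖b‖ * ‖a‖) ^ 2 := by
  rw [mul_pow, Plane.norm_sq, Plane.norm_sq, Plane.inner_eq, Plane.det]
  ring

/-- The two coefficients are the cosine and sine of one angle, so the linear part is a rotation. -/
theorem congruent_normalize {p q : V → Plane} {i k : V} (h : p i ≠ p k) (hq : q i ≠ q k) :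
    Congruent q (normalize p i k q) := by
  have h₁ : ‖p k - p i‖ * ‖q k - q i‖ ≠ 0 := mul_ne_zero (norm_ne_zero_iff.2 (sub_ne_zero.2 h.symm))
    (norm_ne_zero_iff.2 (sub_ne_zero.2 hq.symm))
  have h₂ : (inner ℝ (q k - q i) (p k - p i) / (‖p k - p i‖ * ‖q k - q i‖)) ^ 2 +
      (Plane.det (q k - q i) (p k - p i) / (‖p k - p i‖ * ‖q k - q i‖)) ^ 2 = 1 := by
    rw [div_pow, div_pow, ← add_div, inner_sq_add_det_sq, div_self (pow_ne_zero 2 h₁)]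
  rw [congruent_iff_dist_eq]
  intro v w
  rw [← sq_eq_sq₀ dist_nonneg dist_nonneg, Plane.dist_sq, Plane.dist_sq]
  unfold normalize
  generalize inner ℝ (q k - q i) (p k - p i) / (‖p k - p i‖ * ‖q k - q i‖) = α at *
  generalize Plane.det (q k - q i) (p k - p i) / (‖p k - p i‖ * ‖q k - q i‖) = β at *
  simp only [PiLp.add_apply, PiLp.smul_apply, smul_eq_mul, Plane.rot_apply_zero,
    Plane.rot_apply_one, PiLp.sub_apply]
  linear_combination (-((q v 0 - q w 0) ^ 2 + (q v 1 - q w 1) ^ 2)) * h₂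

theorem normalize_apply_left (p q : V → Plane) (i k : V) : normalize p i k q i = p i := by
  have h : Plane.rot 0 = 0 := Plane.ext' (by simp) (by simp)
  simp [normalize, h]

theorem inner_rot_normalize (p q : V → Plane) (i k : V) :
    inner ℝ (Plane.rot (p k - p i)) (normalize p i k q k - p i) = 0 := by
  unfold normalize
  simp only [Plane.inner_eq, Plane.det, PiLp.add_apply, PiLp.smul_apply, smul_eq_mul,
    Plane.rot_apply_zero, Plane.rot_apply_one, PiLp.sub_apply]
  ring

/-- A framework without nontrivial infinitesimal motions is locally determined up to congruence. -/
theorem determines_of_infinitesimal [Fintype V] {S : Set (Sym2 V ⊕ V × Sym2 V)} {p : V → Plane}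
    {i k : V} (hik : p i ≠ p k) (hS : ∀ c ∈ S, HasFDerivAt (measure c) (fderiv ℝ (measure c) p) p)
    (h : ∀ δ : V → Plane, (∀ c ∈ S, fderiv ℝ (measure c) p δ = 0) →
      ∃ (t : Plane) (ω : ℝ), ∀ v, δ v = t + ω • Plane.rot (p v)) :
    Determines S p := by
  classical
  have : Finite S := Subtype.finite
  have := Fintype.ofFinite S
  -- The last two components fix the gauge: the position of i and the displacement of k normal to
  -- the line through p_i and p_k remove translations and rotations.
  let Φ : (V → Plane) → (S → ℝ) × Plane × ℝ := fun q =>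
    (fun c => measure c q, q i, innerSL ℝ (Plane.rot (p k - p i)) (q k - p i))
  let L : (V → Plane) →L[ℝ] (S → ℝ) × Plane × ℝ :=
    (ContinuousLinearMap.pi fun c : S => fderiv ℝ (measure (c : Sym2 V ⊕ V × Sym2 V)) p).prod
      ((ContinuousLinearMap.proj (R := ℝ) (φ := fun _ : V => Plane) i).prod
        ((innerSL ℝ (Plane.rot (p k - p i))).comp
          (ContinuousLinearMap.proj (R := ℝ) (φ := fun _ : V => Plane) k)))
  have hΦ : HasFDerivAt Φ L p := by
    refine HasFDerivAt.prodMk (hasFDerivAt_pi.2 fun c => hS c c.2) (HasFDerivAt.prodMk ?_ ?_)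
    · exact (ContinuousLinearMap.proj (R := ℝ) (φ := fun _ : V => Plane) i).hasFDerivAt
    · exact (innerSL ℝ (Plane.rot (p k - p i))).hasFDerivAt.comp p
        ((ContinuousLinearMap.proj (R := ℝ) (φ := fun _ : V => Plane) k).hasFDerivAt.sub_const _)
  have hker : LinearMap.ker (L : (V → Plane) →ₗ[ℝ] (S → ℝ) × Plane × ℝ) = ⊥ := by
    rw [LinearMap.ker_eq_bot']
    intro δ hδ
    obtain ⟨h₁, h₂, h₃⟩ : (∀ c : S, fderiv ℝ (measure (c : Sym2 V ⊕ V × Sym2 V)) p δ = 0) ∧ δ i = 0 ∧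
        inner ℝ (Plane.rot (p k - p i)) (δ k) = 0 :=
      ⟨fun c => congrFun (congrArg Prod.fst hδ) c, congrArg (fun x => x.2.1) hδ,
        congrArg (fun x => x.2.2) hδ⟩
    obtain ⟨t, ω, ht⟩ := h δ fun c hc => h₁ ⟨c, hc⟩
    have hi₀ := congrFun (congrArg WithLp.ofLp ((ht i).symm.trans h₂)) 0
    have hi₁ := congrFun (congrArg WithLp.ofLp ((ht i).symm.trans h₂)) 1
    rw [ht k, Plane.inner_eq] at h₃
    simp only [PiLp.add_apply, PiLp.smul_apply, smul_eq_mul, Plane.rot_apply_zero,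
      Plane.rot_apply_one, PiLp.sub_apply, PiLp.zero_apply] at hi₀ hi₁ h₃
    have hω : ω * ((p k 0 - p i 0) ^ 2 + (p k 1 - p i 1) ^ 2) = 0 := by
      linear_combination h₃ + (p k 1 - p i 1) * hi₀ - (p k 0 - p i 0) * hi₁
    have hω' : ω = 0 := (mul_eq_zero.1 hω).resolve_right (Plane.sq_add_sq_pos hik).ne'
    have ht' : t = 0 := by
      apply Plane.ext'
      · simpa [hω'] using hi₀
      · simpa [hω'] using hi₁
    funext v
    simp [ht v, hω', ht']
  -- An injective derivative in finite dimension is bounded below, so p is isolated in its fibre of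
  -- Φ. A nearby configuration that agrees on S normalizes into this fibre, hence to p itself.
  obtain ⟨K, -, hK⟩ := LinearMap.exists_antilipschitzWith _ hker
  have hne : ∀ᶠ z in 𝓝 p, z ≠ p → Φ z ≠ Φ p :=
    eventually_nhdsWithin_iff.1 (hΦ.eventually_ne ⟨K, hK⟩)
  have hN : Filter.Tendsto (normalize p i k) (𝓝 p) (𝓝 p) := by
    simpa [ContinuousAt, normalize_self hik] using continuousAt_normalize hik
  have hqne : ∀ᶠ q in 𝓝 p, q i ≠ q k :=
    (isOpen_ne_fun (continuous_apply i) (continuous_apply k)).mem_nhds hik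
  filter_upwards [hN.eventually hne, hqne] with q hq hqne hagree
  have hcong := congruent_normalize hik hqne
  have hΦq : Φ (normalize p i k q) = Φ p := by
    refine Prod.ext ?_ (Prod.ext ?_ ?_)
    · funext c
      exact (measure_eq_of_congruent hcong c).symm.trans (hagree c c.2).symm
    · exact normalize_apply_left p q i k
    · refine (inner_rot_normalize p q i k).trans ?_
      change 0 = inner ℝ (Plane.rot (p k - p i)) (p k - p i)
      simp only [Plane.inner_eq, Plane.rot_apply_zero, Plane.rot_apply_one]
      ring
  have hfix : normalize p i k q = p := by
    by_contra hcon
    exact hq hcon hΦq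
  rw [hfix] at hcong
  exact hcong.symm

/-! ### Independent rows and the flex of the triangle -/

/-- The weak rigidity matrix of a minimally and infinitesimally weakly rigid framework with at least
one edge has independent rows. -/
theorem range_fderiv_eq_top [Fintype V] {G : FormationGraph V} {p : V → Plane}
    (hp : Function.Injective p) (hinf : G.IsInfinitesimallyWeaklyRigid p) {i k : V}
    (hik : G.graph.Adj i k) (hmin : ∀ c ∈ G.constraints, ¬ Determines (G.constraints \ {c}) p) :
    (ContinuousLinearMap.pi fun c : G.constraints =>
      fderiv ℝ (measure (c : Sym2 V ⊕ V × Sym2 V)) p).range = ⊤ := by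
  classical
  by_contra hne
  obtain ⟨f, hf₀, hf⟩ := Submodule.exists_le_ker_of_lt_top _ (lt_top_iff_ne_top.2 hne)
  have : Finite G.constraints := Subtype.finite
  have := Fintype.ofFinite G.constraints
  -- The functional f is a linear relation among the rows. A row with nonzero coefficient is a
  -- combination of the others, so dropping it leaves the kernel unchanged.
  obtain ⟨c₀, hc₀⟩ : ∃ c, f (Pi.single c 1) ≠ 0 := by
    by_contra! hall
    exact hf₀ (LinearMap.pi_ext' fun c => LinearMap.ext_ring (hall c))
  refine hmin c₀ c₀.2 (determines_of_infinitesimal (hp.ne hik.ne)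
    (fun c hc => (hasStrictFDerivAt_measure hp hc.1).hasFDerivAt) fun δ hδ => ?_)
  have hsingle : (ContinuousLinearMap.pi fun c : G.constraints =>
      fderiv ℝ (measure (c : Sym2 V ⊕ V × Sym2 V)) p) δ =
      fderiv ℝ (measure (c₀ : Sym2 V ⊕ V × Sym2 V)) p δ • Pi.single c₀ 1 := by
    funext c
    by_cases hc : c = c₀
    · subst hc
      simp
    · simpa [hc] using hδ c ⟨c.2, fun h => hc (Subtype.ext h)⟩
  have hzero : fderiv ℝ (measure (c₀ : Sym2 V ⊕ V × Sym2 V)) p δ = 0 := by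
    have h := LinearMap.mem_ker.1 (hf ⟨δ, rfl⟩)
    change f ((ContinuousLinearMap.pi fun c : G.constraints =>
      fderiv ℝ (measure (c : Sym2 V ⊕ V × Sym2 V)) p) δ) = 0 at h
    rw [hsingle, map_smul, smul_eq_mul] at h
    exact (mul_eq_zero.1 h).resolve_right hc₀
  obtain ⟨t, ω, s, hs, htriv⟩ := hinf δ (isInfinitesimalWeakMotion_iff.2 fun c hc => by
    by_cases h : c = c₀
    · rwa [h]
    · exact hδ c ⟨hc, h⟩)
  -- The edge ik rules out scalings.
  have hs₀ : s = 0 := hs fun hbot => by simp [hbot] at hik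
  refine ⟨t, ω, fun v => ?_⟩
  rw [htriv v, hs₀, zero_smul, add_zero]
  rfl

/-- With independent rows, the triangle `ijk` of edges flexes once the lengths of `ij` and `ik` are
replaced by the angle at `k`. -/
theorem not_determines_of_range_eq_top [Fintype V] {G : FormationGraph V} {p : V → Plane}
    (hp : Function.Injective p) {i j k : V} (hij : G.graph.Adj i j) (hik : G.graph.Adj i k)
    (hjk : G.graph.Adj j k)
    (hrange : (ContinuousLinearMap.pi fun c : G.constraints =>
      fderiv ℝ (measure (c : Sym2 V ⊕ V × Sym2 V)) p).range = ⊤) :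
    ¬ Determines (G.constraints \ {.inl s(i, j), .inl s(i, k)} ∪ {.inr (k, s(i, j))}) p := by
  classical
  have : Finite G.constraints := Subtype.finite
  have := Fintype.ofFinite G.constraints
  have hderiv : HasStrictFDerivAt
      (fun (q : V → Plane) (c : G.constraints) => measure (c : Sym2 V ⊕ V × Sym2 V) q)
      (ContinuousLinearMap.pi fun c : G.constraints =>
        fderiv ℝ (measure (c : Sym2 V ⊕ V × Sym2 V)) p) p :=
    hasStrictFDerivAt_pi.2 fun c => hasStrictFDerivAt_measure hp c.2
  -- All values near those of p are attained by configurations near p.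
  have hmap := hderiv.map_nhds_eq_of_surj hrange
  have hA : 0 < measure (.inl s(i, k)) p := by
    have := norm_pos_iff.2 (sub_ne_zero.2 (hp.ne hik.ne))
    rw [measure_inl]
    positivity
  have hB : 0 < measure (.inl s(j, k)) p := by
    have := norm_pos_iff.2 (sub_ne_zero.2 (hp.ne hjk.ne))
    rw [measure_inl]
    positivity
  -- Target values: the squared length of ik grows by ε, that of ij follows from the law of cosines
  -- with the old angle at k, and the rest stay.
  let γ : ℝ → G.constraints → ℝ := fun ε c =>
    if (c : Sym2 V ⊕ V × Sym2 V) = .inl s(i, k) then measure (.inl s(i, k)) p + ε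
    else if (c : Sym2 V ⊕ V × Sym2 V) = .inl s(i, j) then
      measure (.inl s(i, k)) p + ε + measure (.inl s(j, k)) p -
        2 * (√(measure (.inl s(i, k)) p + ε) * √(measure (.inl s(j, k)) p)) *
          measure (.inr (k, s(i, j))) p
    else measure c p
  have hγ : Filter.Tendsto γ (𝓝[≠] 0) (𝓝 fun c => measure (c : Sym2 V ⊕ V × Sym2 V) p) := by
    refine Filter.Tendsto.mono_left (Continuous.tendsto' (continuous_pi fun c => ?_) _ _ ?_)
      nhdsWithin_le_nhds
    · simp only [γ]
      split_ifs <;> fun_prop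
    · funext c
      simp only [γ, add_zero]
      split_ifs with h₁ h₂
      · rw [h₁]
      · rw [h₂, measure_inl_eq k i j p]
      · rfl
  rw [not_determines_iff, Filter.frequently_iff]
  intro U hU
  have himage : (fun (q : V → Plane) (c : G.constraints) =>
      measure (c : Sym2 V ⊕ V × Sym2 V) q) '' U ∈
      𝓝 fun c : G.constraints => measure (c : Sym2 V ⊕ V × Sym2 V) p :=
    hmap ▸ Filter.image_mem_map hU
  -- Needed to divide by the new length of ik when recovering the angle at k.
  have hpos : ∀ᶠ ε : ℝ in 𝓝[≠] 0, 0 < measure (.inl s(i, k)) p + ε := by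
    refine nhdsWithin_le_nhds ?_
    filter_upwards [lt_mem_nhds (neg_lt_zero.2 hA)] with ε hε
    linarith
  obtain ⟨ε, ⟨⟨q, hqU, hq⟩, hε₀⟩, hε⟩ :=
    (((hγ.eventually himage).and self_mem_nhdsWithin).and hpos).exists
  have hval : ∀ c (hc : c ∈ G.constraints), measure c q = γ ε ⟨c, hc⟩ :=
    fun c hc => congrFun hq ⟨c, hc⟩
  have hqA : measure (.inl s(i, k)) q = measure (.inl s(i, k)) p + ε := by
    rw [hval _ (by simpa using hik)]
    simp [γ]
  have hqB : measure (.inl s(j, k)) q = measure (.inl s(j, k)) p := by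
    rw [hval _ (by simpa using hjk)]
    simp [γ, hij.ne', hik.ne', hjk.ne, hjk.ne']
  have hqC : measure (.inl s(i, j)) q = measure (.inl s(i, k)) p + ε + measure (.inl s(j, k)) p -
        2 * (√(measure (.inl s(i, k)) p + ε) * √(measure (.inl s(j, k)) p)) *
          measure (.inr (k, s(i, j))) p := by
    rw [hval _ (by simpa using hij)]
    simp [γ, hik.ne, hjk.ne]
  refine ⟨q, hqU, ?_, fun hcong => hε₀ ?_⟩
  · rintro c (⟨hc, hc'⟩ | rfl)
    · simp only [Set.mem_insert_iff, Set.mem_singleton_iff, not_or] at hc'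
      rw [hval c hc]
      simp [γ, hc'.1, hc'.2]
    · have h₁ : √(measure (.inl s(i, k)) p + ε) * √(measure (.inl s(j, k)) p) ≠ 0 :=
        (mul_pos (Real.sqrt_pos.2 hε) (Real.sqrt_pos.2 hB)).ne'
      rw [measure_inr_eq k i j q, hqA, hqB, hqC, eq_div_iff h₁]
      ring
  · have := measure_eq_of_congruent hcong (.inl s(i, k))
    rw [hqA] at this
    simpa using this

/-! ### Minimality of the extensions -/

theorem not_determines_of_imp {S T : Set (Sym2 V ⊕ V × Sym2 V)} {p : V → Plane}
    (hS : ¬ Determines S p) (h : ∀ q, AgreeOn S p q → AgreeOn T p q) : ¬ Determines T p :=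
  fun hT => hS (hT.mono fun q hq hagree => hq (h q hagree))

theorem not_determines_diff_newAngle {p : V → Plane} {x : Plane} {i j : V} (hx : x ∉ Set.range p)
    {c : Sym2 (Option V) ⊕ Option V × Sym2 (Option V)} (hc : c ∈ newAngles i j)
    (S : Set (Sym2 V ⊕ V × Sym2 V)) :
    ¬ Determines ((liftConstraint '' S ∪ newAngles i j) \ {c}) (extendConfiguration p x) := by
  have hx' : ∀ v, x ≠ p v := fun v h => hx ⟨v, h.symm⟩
  rcases hc with rfl | rfl
  · refine not_determines_of_single_angle (i := i) (hx' j) (S := S) ?_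
    rintro d ⟨hd | rfl | hd, hd'⟩
    exacts [.inl hd, absurd rfl hd', .inr hd]
  · refine not_determines_of_single_angle (i := j) (hx' i) (S := S) ?_
    rintro d ⟨hd | hd | rfl, hd'⟩
    exacts [.inl hd, .inr hd, absurd rfl hd']

theorem image_liftConstraint_union_diff_subset (S : Set (Sym2 V ⊕ V × Sym2 V))
    (N : Set (Sym2 (Option V) ⊕ Option V × Sym2 (Option V))) (c : Sym2 V ⊕ V × Sym2 V) :
    (liftConstraint '' S ∪ N) \ {liftConstraint c} ⊆ liftConstraint '' (S \ {c}) ∪ N := by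
  rintro _ ⟨⟨d, hd, rfl⟩ | hd, hd'⟩
  · exact .inl ⟨d, ⟨hd, fun h => hd' (congrArg liftConstraint h)⟩, rfl⟩
  · exact .inr hd

theorem ne_of_affineIndependent {a b c : Plane} (h : AffineIndependent ℝ ![a, b, c]) : a ≠ b :=
  h.injective.ne (show (0 : Fin 3) ≠ 1 by decide)

theorem minimallyDetermines_extendConfiguration [Finite V] {p : V → Plane} {x : Plane} {i j : V}
    {S : Set (Sym2 V ⊕ V × Sym2 V)} {T : Set (Sym2 (Option V) ⊕ Option V × Sym2 (Option V))}
    (hx : AffineIndependent ℝ ![p i, p j, x]) (hxp : x ∉ Set.range p) (hS : Determines S p)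
    (hmin : ∀ c ∈ S, ¬ Determines (S \ {c}) p) (hT : T = liftConstraint '' S ∪ newAngles i j) :
    Determines T (extendConfiguration p x) ∧
      ∀ c ∈ T, ¬ Determines (T \ {c}) (extendConfiguration p x) := by
  subst hT
  refine ⟨determines_extendConfiguration hx Set.subset_union_right hS fun q hq => ?_, ?_⟩
  · have hagree := agreeOn_image_liftConstraint.1 (hq.mono Set.subset_union_left)
    rwa [extendConfiguration_comp_some] at hagree
  · rintro _ (⟨c, hc, rfl⟩ | hc)
    · exact not_determines_extendConfiguration (ne_of_affineIndependent hx) x (hmin c hc)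
        (image_liftConstraint_union_diff_subset S _ c)
    · exact not_determines_diff_newAngle hxp hc S

variable {G : FormationGraph V} {i j k : V}

/-- The deleted length ij is recovered from ik, jk and the angle at k, so agreement on the extension
forces agreement on the old constraints. -/
theorem determines_oneExtension [Finite V] (hij : G.graph.Adj i j) (hik : G.graph.Adj i k)
    (hjk : G.graph.Adj j k) {p : V → Plane} {x : Plane} (hx : AffineIndependent ℝ ![p i, p j, x])
    (hG : Determines G.constraints p) :
    Determines (G.oneExtension i j k hij hik hjk).constraints (extendConfiguration p x) := by
  rw [constraints_oneExtension]
  refine determines_extendConfiguration hx Set.subset_union_right hG fun q hq => ?_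
  have hagree := agreeOn_image_liftConstraint.1 (hq.mono Set.subset_union_left)
  rw [extendConfiguration_comp_some] at hagree
  have hik' := hagree (.inl s(i, k)) (.inl ⟨by simpa using hik, by simp [hij.ne, hjk.ne']⟩)
  have hjk' := hagree (.inl s(j, k)) (.inl ⟨by simpa using hjk, by simp [hij.ne', hik.ne']⟩)
  intro c hc
  by_cases h : c = .inl s(i, j)
  · rw [h, measure_inl_eq k i j p, measure_inl_eq k i j (q ∘ some), hik', hjk', hagree _ (.inr rfl)]
  · exact hagree c (.inl ⟨hc, h⟩)

theorem not_determines_oneExtension_diff (hij : G.graph.Adj i j) (hik : G.graph.Adj i k)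
    (hjk : G.graph.Adj j k) {p : V → Plane} {x : Plane} (hx : AffineIndependent ℝ ![p i, p j, x])
    (hxp : x ∉ Set.range p) (hmin : ∀ c ∈ G.constraints, ¬ Determines (G.constraints \ {c}) p) :
    ∀ c ∈ (G.oneExtension i j k hij hik hjk).constraints, c ≠ .inl s(some i, some k) →
      c ≠ .inl s(some j, some k) →
      ¬ Determines ((G.oneExtension i j k hij hik hjk).constraints \ {c})
        (extendConfiguration p x) := by
  rw [constraints_oneExtension]
  rintro _ (⟨c, hc, rfl⟩ | hc) hci hcj
  · refine not_determines_extendConfiguration (ne_of_affineIndependent hx) x ?_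
      (image_liftConstraint_union_diff_subset _ _ c)
    by_cases hct : c = .inr (k, s(i, j))
    · subst hct
      refine not_determines_of_imp (hmin (.inl s(i, j)) (by simpa using hij)) fun q hq => hq.mono ?_
      rintro d ⟨hd | hd, hd'⟩
      exacts [hd, absurd hd hd']
    · obtain ⟨hc, hc'⟩ := hc.resolve_right hct
      refine not_determines_of_imp (hmin c hc) fun q hq => ?_
      rintro d ⟨hd | rfl, hd'⟩
      · exact hq d ⟨hd.1, hd'⟩
      -- A flex of the old framework without c still preserves all three sides of the triangle,
      -- hence the angle at k. Excluding ik and jk matters only here.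
      · rw [measure_inr_eq, measure_inr_eq, hq (.inl s(i, j)) ⟨by simpa using hij, Ne.symm hc'⟩,
          hq (.inl s(i, k)) ⟨by simpa using hik, ?_⟩, hq (.inl s(j, k)) ⟨by simpa using hjk, ?_⟩]
        · rintro rfl
          exact hcj rfl
        · rintro rfl
          exact hci rfl
  · exact not_determines_diff_newAngle hxp hc _

theorem not_determines_oneExtension_diff_edge [Fintype V] {p : V → Plane}
    (hp : Function.Injective p) (hij : G.graph.Adj i j) (hik : G.graph.Adj i k)
    (hjk : G.graph.Adj j k)
    (hrange : (ContinuousLinearMap.pi fun c : G.constraints =>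
      fderiv ℝ (measure (c : Sym2 V ⊕ V × Sym2 V)) p).range = ⊤) (x : Plane) :
    ¬ Determines ((G.oneExtension i j k hij hik hjk).constraints \ {.inl s(some i, some k)})
      (extendConfiguration p x) := by
  rw [constraints_oneExtension, ← liftConstraint_inl]
  refine not_determines_extendConfiguration (hp.ne hij.ne) x ?_
    (image_liftConstraint_union_diff_subset _ _ _)
  refine not_determines_of_imp (not_determines_of_range_eq_top hp hij hik hjk hrange)
    fun q hq => hq.mono ?_
  rintro d ⟨⟨hd, hd₁⟩ | hd, hd₂⟩
  · exact .inl ⟨hd, fun h => h.elim hd₁ hd₂⟩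
  · exact .inr hd

theorem constraints_oneExtension_swap (hij : G.graph.Adj i j) (hik : G.graph.Adj i k)
    (hjk : G.graph.Adj j k) : (G.oneExtension i j k hij hik hjk).constraints =
      (G.oneExtension j i k hij.symm hjk hik).constraints := by
  rw [constraints_oneExtension, constraints_oneExtension, newAngles_comm, Sym2.eq_swap]

end FormationGraph

open FormationGraph in
theorem mainTheorem5 {V : Type*} [Fintype V] (G : FormationGraph V) (p : V → Plane)
    (hp : Function.Injective p)
    (hG : G.IsMinimallyRigid p ∨ G.IsMinimallyWeaklyRigid p) :
    (∀ (i j : V) (hij : i ≠ j) (x : Plane), x ∉ Set.range p →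
      AffineIndependent ℝ ![p i, p j, x] →
        (G.zeroExtension i j hij).IsMinimallyWeaklyRigid (extendConfiguration p x)) ∧
    (∀ (i j k : V) (hij : G.graph.Adj i j) (hik : G.graph.Adj i k) (hjk : G.graph.Adj j k)
      (x : Plane), x ∉ Set.range p → AffineIndependent ℝ ![p i, p j, x] →
        (G.oneExtension i j k hij hik hjk).IsWeaklyRigid (extendConfiguration p x) ∧
        (∀ e ∈ (G.oneExtension i j k hij hik hjk).graph.edgeSet,
          e ≠ s(some i, some k) → e ≠ s(some j, some k) →
            ¬ ((G.oneExtension i j k hij hik hjk).deleteEdge e).IsWeaklyRigid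
              (extendConfiguration p x)) ∧
        (∀ a ∈ (G.oneExtension i j k hij hik hjk).angles,
          ¬ ((G.oneExtension i j k hij hik hjk).deleteAngle a).IsWeaklyRigid
            (extendConfiguration p x)) ∧
        (G.IsInfinitesimallyWeaklyRigid p →
          (G.oneExtension i j k hij hik hjk).IsMinimallyWeaklyRigid
            (extendConfiguration p x))) := by
  have hmin := isMinimallyWeaklyRigid_iff.1 (hG.elim IsMinimallyRigid.isMinimallyWeaklyRigid id)
  refine ⟨fun i j hij x hxp hx => isMinimallyWeaklyRigid_iff.2 ?_,
    fun i j k hij hik hjk x hxp hx => ?_⟩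
  · exact minimallyDetermines_extendConfiguration hx hxp hmin.1 hmin.2
      (constraints_zeroExtension G hij)
  · have hrigid := determines_oneExtension hij hik hjk hx hmin.1
    have hremove := not_determines_oneExtension_diff hij hik hjk hx hxp hmin.2
    refine ⟨isWeaklyRigid_iff.2 hrigid, fun e he hei hej => ?_, fun a ha => ?_, fun hinf => ?_⟩
    · rw [isWeaklyRigid_iff, constraints_deleteEdge]
      exact hremove _ (inl_mem_constraints.2 he) (by simpa using hei) (by simpa using hej)
    · rw [isWeaklyRigid_iff, constraints_deleteAngle]
      exact hremove _ (inr_mem_constraints.2 ha) (by simp) (by simp)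
    · refine isMinimallyWeaklyRigid_iff.2 ⟨hrigid, fun c hc => ?_⟩
      have hrange := range_fderiv_eq_top hp hinf hij hmin.2
      by_cases hci : c = .inl s(some i, some k)
      · rw [hci]
        exact not_determines_oneExtension_diff_edge hp hij hik hjk hrange x
      · by_cases hcj : c = .inl s(some j, some k)
        -- The construction is symmetric in i and j, so the edge jk reduces to the edge ik.
        · rw [hcj, constraints_oneExtension_swap]
          exact not_determines_oneExtension_diff_edge hp hij.symm hjk hik hrange x
        · exact hremove c hc hci hcj
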